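/- Conventions. A stereotype space is a Hausdorff locally convex space $X$ over $\mathbb{C}$ for which the natural map $X\to X^{\star\star}$ is an isomorphism of topological vector spaces, where $X^\star$ is the space of continuous linear functionals with the topology of uniform convergence on totally bounded sets. A stereotype algebra is a stereotype space $A$ with an associative unital multiplication such that for every totally bounded $K\subseteq A$ and every neighbourhood $U$ of $0$ there is a neighbourhood $V$ of $0$ with $K\cdot V\subseteq U$ and $V\cdot K\subseteq U$; a left stereotype $A$-module is a stereotype space $X$ with a unital left $A$-module structure whose action $A\times X\to X$ is continuous in the same sense (for totally bounded subsets of $A$ and of $X$). For a locally convex space $E$, its pseudocompletion $E^\triangledown$ is the least subspace of the completion of $E$ that contains the image of $E$ and in which every totally bounded Cauchy net converges. Let $A$ be an involutive stereotype algebra, that is, a (not necessarily commutative) stereotype algebra with a continuous involution. Let $\mathrm{Spec}(A)$ be the set of continuous unital involutive characters $t:A\to\mathbb{C}$, with the topology of uniform convergence on totally bounded sets, and let $I_t=\ker t$. For a left stereotype $A$-module $X$ and $n\ge 0$ put $$J^n_t(X)=\big(X/\overline{I_t^{n+1}\cdot X}\big)^\triangledown,\qquad J^n_A(X)=\bigsqcup_{t\in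 \mathrm{Spec}(A)}J^n_t(X),\qquad j^n(x)(t)=x+\overline{I_t^{n+1}\cdot X}\quad(x\in X),$$ where $I_t^{n+1}\cdot X$ is the linear span of all $a_1\cdots a_{n+1}\cdot x$ with $a_i\in I_t$, $x\in X$. Let $\pi:J^n_A(X)\to\mathrm{Spec}(A)$ be the projection. For a continuous seminorm $p$ on $X$ let $p^n_t$ be the extension by continuity to $J^n_t(X)$ of the quotient seminorm $x+\overline{I_t^{n+1}\cdot X}\mapsto\inf\{p(x+y): y\in\overline{I_t^{n+1}\cdot X}\}$. The set $J^n_A(X)$ carries the topology generated by the sets $$W(x,U,p,\varepsilon)=\{\xi:\ \pi(\xi)\in U,\ p^n_{\pi(\xi)}\big(\xi-j^n(x)(\pi(\xi))\big)<\varepsilon\},$$ with $x\in X$, $U\subseteq\mathrm{Spec}(A)$ open, $p$ a continuous seminorm on $X$ and $\varepsilon>0$. Theorem. Let $X,Y$ be left stereotype modules over an involutive stereotype algebra $A$, let $n\ge 0$, and let $D:X\to Y$ be a differential operator of order at most $n$, that is, a continuous $\mathbb{C}$-linear map with $[\dots[[D,a_0],a_1],\dots,a_n]=0$ for all $a_0,\dots,a_n\in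 A$, where $[P,a](x)=P(a\cdot x)-a\cdot P(x)$. Then there is a morphism of bundles $j_n[D]:J^n_A(X)\to J^0_A(Y)$, that is, a continuous map which for every $t\in\mathrm{Spec}(A)$ maps the fiber $J^n_t(X)$ into the fiber $J^0_t(Y)$, $\mathbb{C}$-linearly, such that $$j^0(Dx)=j_n[D]\circ j^n(x)\qquad\text{for all }x\in X.$$ -/

import Mathlib

open Set Filter Topology UniformSpace Uniformity

set_option linter.unusedSectionVars false

/-! ## Stereotype spaces, algebras and modules -/

/-- The dual space `X⋆` of continuous linear functionals, with the topology of uniform convergence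
on totally bounded subsets of `X`. -/
abbrev StereotypeDual (X : Type*) [AddCommGroup X] [Module ℂ X] [UniformSpace X] : Type _ :=
  UniformConvergenceCLM (RingHom.id ℂ) (E := X) ℂ {S : Set X | TotallyBounded S}

/-- A stereotype space: a Hausdorff locally convex space over `ℂ` for which the natural map
`x ↦ (f ↦ f x)` is an isomorphism of topological vector spaces from `X` onto `X⋆⋆`. -/
structure IsStereotypeSpace (X : Type*) [AddCommGroup X] [Module ℂ X] [UniformSpace X] : Prop where
  isUniformAddGroup : IsUniformAddGroup X
  continuousSMul : ContinuousSMul ℂ X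
  locallyConvexSpace : LocallyConvexSpace ℝ X
  t2Space : T2Space X
  reflexive : ∃ e : X ≃L[ℂ] StereotypeDual (StereotypeDual X),
    ∀ (x : X) (f : StereotypeDual X), e x f = f x

/-- A (unital, associative, not necessarily commutative) stereotype algebra: the multiplication is
continuous in the sense of stereotype spaces, that is, `K · V ⊆ U` and `V · K ⊆ U` for every totally
bounded `K`, every neighbourhood `U` of zero, and some neighbourhood `V` of zero. -/
structure IsStereotypeAlgebra (A : Type*) [Ring A] [Algebra ℂ A] [UniformSpace A] : Prop where
  isStereotypeSpace : IsStereotypeSpace A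
  mul_continuous : ∀ K : Set A, TotallyBounded K → ∀ U ∈ 𝓝 (0 : A), ∃ V ∈ 𝓝 (0 : A),
    ∀ a ∈ K, ∀ b ∈ V, a * b ∈ U ∧ b * a ∈ U

/-- A stereotype algebra with a continuous involution. -/
structure IsInvolutiveStereotypeAlgebra (A : Type*) [Ring A] [StarRing A] [Algebra ℂ A]
    [StarModule ℂ A] [UniformSpace A] : Prop where
  isStereotypeAlgebra : IsStereotypeAlgebra A
  continuous_star : Continuous (star : A → A)

/-- A left stereotype module `X` over `A`: the action `A × X → X` is continuous in the sense of
stereotype spaces. -/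
structure IsStereotypeModule (A X : Type*) [Ring A] [Algebra ℂ A] [UniformSpace A]
    [AddCommGroup X] [Module ℂ X] [Module A X] [IsScalarTower ℂ A X] [UniformSpace X] : Prop where
  isStereotypeSpace : IsStereotypeSpace X
  smul_continuous_right : ∀ K : Set A, TotallyBounded K → ∀ U ∈ 𝓝 (0 : X), ∃ V ∈ 𝓝 (0 : X),
    ∀ a ∈ K, ∀ x ∈ V, a • x ∈ U
  smul_continuous_left : ∀ K : Set X, TotallyBounded K → ∀ U ∈ 𝓝 (0 : X), ∃ V ∈ 𝓝 (0 : A),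
    ∀ a ∈ V, ∀ x ∈ K, a • x ∈ U

/-! ## The involutive spectrum -/

/-- The involutive spectrum of `A`: continuous unital involutive characters `A → ℂ`. -/
def InvolutiveSpec (A : Type*) [Ring A] [StarRing A] [Algebra ℂ A] [TopologicalSpace A] : Type _ :=
  {t : A →⋆ₐ[ℂ] ℂ // Continuous t}

/-- The value `t(a)` of a character. -/
noncomputable def InvolutiveSpec.eval {A : Type*} [Ring A] [StarRing A] [Algebra ℂ A] [TopologicalSpace A]
    (t : InvolutiveSpec A) (a : A) : ℂ := t.1 a

/-- The spectrum carries the topology of uniform convergence on totally bounded sets of `A`. -/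
noncomputable instance InvolutiveSpec.instTopologicalSpace {A : Type*} [Ring A] [StarRing A] [Algebra ℂ A]
    [UniformSpace A] : TopologicalSpace (InvolutiveSpec A) :=
  TopologicalSpace.induced
    (fun t => UniformOnFun.ofFun {S : Set A | TotallyBounded S} t.eval) inferInstance

/-! ## Pseudocompletion -/

/-- Every totally bounded Cauchy filter (net) in `S` converges to a point of `S`. -/
def IsPseudocompleteSet {E : Type*} [UniformSpace E] (S : Set E) : Prop :=
  ∀ F : Filter E, Cauchy F → (∃ T ∈ F, TotallyBounded T ∧ T ⊆ S) → ∃ x ∈ S, F ≤ 𝓝 x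

/-- The pseudocompletion `E^▽` of a topological vector space `E`: the least pseudocomplete
subspace of the completion of `E` that contains (the image of) `E`. -/
noncomputable def pseudocompletion (E : Type*) [AddCommGroup E] [Module ℂ E] [UniformSpace E]
    [IsUniformAddGroup E] [UniformContinuousConstSMul ℂ E] : Submodule ℂ (Completion E) :=
  sInf {P | (∀ e : E, (e : Completion E) ∈ P) ∧ IsPseudocompleteSet (P : Set (Completion E))}

theorem coe_mem_pseudocompletion {E : Type*} [AddCommGroup E] [Module ℂ E] [UniformSpace E]
    [IsUniformAddGroup E] [UniformContinuousConstSMul ℂ E] (e : E) :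
    (e : Completion E) ∈ pseudocompletion E :=
  (Submodule.mem_sInf).2 fun _ hP => hP.1 e

/-! ## Quotients of topological vector spaces -/

section Quotient

variable {X : Type*} [AddCommGroup X] [Module ℂ X] [UniformSpace X] [IsUniformAddGroup X]

/-- The group uniformity of the quotient topology. -/
instance Submodule.quotientUniformSpace (N : Submodule ℂ X) : UniformSpace (X ⧸ N) :=
  IsTopologicalAddGroup.rightUniformSpace (X ⧸ N)

instance Submodule.quotient_isUniformAddGroup (N : Submodule ℂ X) : IsUniformAddGroup (X ⧸ N) :=
  isUniformAddGroup_of_addCommGroup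

instance Submodule.quotient_uniformContinuousConstSMul [ContinuousSMul ℂ X] (N : Submodule ℂ X) :
    UniformContinuousConstSMul ℂ (X ⧸ N) :=
  uniformContinuousConstSMul_of_continuousConstSMul ℂ (X ⧸ N)

/-- The quotient seminorm `x + N ↦ inf_{y ∈ N} p (x + y)`. -/
noncomputable def quotientSeminorm (N : Submodule ℂ X) (p : Seminorm ℂ X) (q : X ⧸ N) : ℝ :=
  sInf (p '' {x : X | N.mkQ x = q})

theorem quotientSeminorm_mkQ_le (N : Submodule ℂ X) (p : Seminorm ℂ X) (x : X) :
    quotientSeminorm N p (N.mkQ x) ≤ p x :=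
  csInf_le ⟨0, by rintro _ ⟨y, -, rfl⟩; exact apply_nonneg p y⟩ ⟨x, rfl, rfl⟩

theorem quotientSeminorm_le_add (N : Submodule ℂ X) (p : Seminorm ℂ X) (q r : X ⧸ N) :
    quotientSeminorm N p q ≤ quotientSeminorm N p r + quotientSeminorm N p (q - r) := by
  have hne : ∀ s : X ⧸ N, (p '' {x : X | N.mkQ x = s}).Nonempty := fun s =>
    (N.mkQ_surjective s).elim fun x hx => ⟨p x, x, hx, rfl⟩
  refine le_of_forall_pos_lt_add fun ε hε => ?_
  obtain ⟨_, ⟨x, hx, rfl⟩, hx'⟩ := Real.lt_sInf_add_pos (hne r) (half_pos hε)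
  obtain ⟨_, ⟨y, hy, rfl⟩, hy'⟩ := Real.lt_sInf_add_pos (hne (q - r)) (half_pos hε)
  have hxy : N.mkQ (x + y) = q := by
    rw [map_add, show N.mkQ x = r from hx, show N.mkQ y = q - r from hy]; abel
  have h1 := quotientSeminorm_mkQ_le N p (x + y)
  have h2 := map_add_le_add p x y
  rw [hxy] at h1
  change p x < quotientSeminorm N p r + ε / 2 at hx'
  change p y < quotientSeminorm N p (q - r) + ε / 2 at hy'
  linarith

theorem uniformContinuous_quotientSeminorm (N : Submodule ℂ X) {p : Seminorm ℂ X}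
    (hp : Continuous p) : UniformContinuous (quotientSeminorm N p) := by
  have h0 : ∀ ε > 0, ∀ᶠ q in 𝓝 (0 : X ⧸ N), quotientSeminorm N p q < ε := by
    intro ε hε
    have hopen : IsOpen (N.mkQ '' {x : X | p x < ε}) :=
      N.isOpenMap_mkQ _ (isOpen_lt hp continuous_const)
    refine mem_of_superset (hopen.mem_nhds ⟨0, by simpa using hε, map_zero _⟩) ?_
    rintro _ ⟨x, hx, rfl⟩
    exact (quotientSeminorm_mkQ_le N p x).trans_lt hx
  have key : Tendsto (fun z : (X ⧸ N) × (X ⧸ N) => z.2 - z.1) (𝓤 (X ⧸ N)) (𝓝 0) := by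
    rw [uniformity_eq_comap_nhds_zero]
    exact tendsto_comap
  have key' : Tendsto (fun z : (X ⧸ N) × (X ⧸ N) => z.1 - z.2) (𝓤 (X ⧸ N)) (𝓝 0) := by
    simpa using key.neg
  refine Metric.uniformity_basis_dist.tendsto_right_iff.2 fun ε hε => ?_
  filter_upwards [key (h0 ε hε), key' (h0 ε hε)] with z h1 h2
  change quotientSeminorm N p (z.2 - z.1) < ε at h1
  change quotientSeminorm N p (z.1 - z.2) < ε at h2
  have h3 := quotientSeminorm_le_add N p z.1 z.2
  have h4 := quotientSeminorm_le_add N p z.2 z.1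
  change dist _ _ < ε
  rw [Real.dist_eq, abs_lt]
  constructor <;> linarith

/-- The extension by continuity of the quotient seminorm to the completion of `X ⧸ N`. -/
noncomputable def completedQuotientSeminorm (N : Submodule ℂ X) (p : Seminorm ℂ X) :
    Completion (X ⧸ N) → ℝ :=
  Completion.extension (quotientSeminorm N p)

theorem completedQuotientSeminorm_coe (N : Submodule ℂ X) {p : Seminorm ℂ X} (hp : Continuous p)
    (q : X ⧸ N) : completedQuotientSeminorm N p (q : Completion (X ⧸ N)) = quotientSeminorm N p q :=
  Completion.extension_coe (uniformContinuous_quotientSeminorm N hp) q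

end Quotient

/-! ## Jet bundles -/

section Jets

variable {A : Type*} [Ring A] [StarRing A] [Algebra ℂ A] [UniformSpace A]

/-- The subspace `I_t ^ k · X` of `X`, where `I_t` is the kernel of the character `t`: the span of
all `a₁ ⋯ a_k · x` with `a₁, …, a_k ∈ I_t` and `x ∈ X`. -/
def kerPowSMul (X : Type*) [AddCommGroup X] [Module ℂ X] [Module A X] (k : ℕ)
    (t : InvolutiveSpec A) : Submodule ℂ X :=
  Submodule.span ℂ {y | ∃ (l : List A) (x : X),
    l.length = k ∧ (∀ a ∈ l, t.eval a = 0) ∧ y = l.prod • x}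

variable (X : Type*) [AddCommGroup X] [Module ℂ X] [Module A X] [UniformSpace X]
  [IsUniformAddGroup X] [ContinuousSMul ℂ X]

/-- The closure of `I_t ^ (n + 1) · X`. -/
def jetKernel (n : ℕ) (t : InvolutiveSpec A) : Submodule ℂ X :=
  (kerPowSMul X (n + 1) t).topologicalClosure

/-- The space of jets of order `n` of `X` at `t`: the pseudocompletion of the quotient of `X`
by the closure of `I_t ^ (n + 1) · X`. -/
abbrev JetFiber (n : ℕ) (t : InvolutiveSpec A) : Type _ :=
  pseudocompletion (X ⧸ jetKernel X n t)

/-- The total space of the bundle of jets of order `n` of the `A`-module `X`: the disjoint union of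
the fibers over the spectrum of `A`. -/
structure JetBundle (A : Type*) [Ring A] [StarRing A] [Algebra ℂ A] [UniformSpace A]
    (X : Type*) [AddCommGroup X] [Module ℂ X] [Module A X] [UniformSpace X]
    [IsUniformAddGroup X] [ContinuousSMul ℂ X] (n : ℕ) where
  /-- The projection to the base. -/
  proj : InvolutiveSpec A
  /-- The point of the fiber. -/
  val : JetFiber X n proj

variable {X}

/-- The class of `x` in the space of jets of order `n` at `t`. -/
noncomputable def jetAt (n : ℕ) (t : InvolutiveSpec A) (x : X) : JetFiber X n t :=
  ⟨((jetKernel X n t).mkQ x : Completion (X ⧸ jetKernel X n t)), coe_mem_pseudocompletion _⟩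

/-- The section `j^n(x)` of the jet bundle. -/
noncomputable def jet (A : Type*) [Ring A] [StarRing A] [Algebra ℂ A] [UniformSpace A]
    {X : Type*} [AddCommGroup X] [Module ℂ X] [Module A X] [UniformSpace X]
    [IsUniformAddGroup X] [ContinuousSMul ℂ X] (n : ℕ) (x : X) (t : InvolutiveSpec A) :
    JetBundle A X n :=
  ⟨t, jetAt n t x⟩

/-- The seminorm `p^n_t` on the space of jets at `t` determined by a continuous seminorm `p`
on `X`. -/
noncomputable def jetSeminorm (n : ℕ) (t : InvolutiveSpec A) (p : Seminorm ℂ X)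
    (ξ : JetFiber X n t) : ℝ :=
  completedQuotientSeminorm (jetKernel X n t) p ξ

/-- The basic open set `W(x, U, p, ε)` of the jet bundle. -/
def jetNhd (n : ℕ) (x : X) (U : Set (InvolutiveSpec A)) (p : Seminorm ℂ X) (ε : ℝ) :
    Set (JetBundle A X n) :=
  {ξ | ξ.proj ∈ U ∧ jetSeminorm n ξ.proj p (ξ.val - jetAt n ξ.proj x) < ε}

/-- The topology of the jet bundle, generated by the sets `W(x, U, p, ε)` with `x ∈ X`, `U` open,
`p` a continuous seminorm on `X` and `ε > 0`. -/
instance JetBundle.instTopologicalSpace (n : ℕ) : TopologicalSpace (JetBundle A X n) :=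
  TopologicalSpace.generateFrom
    {W | ∃ (x : X) (U : Set (InvolutiveSpec A)) (p : Seminorm ℂ X) (ε : ℝ),
      IsOpen U ∧ Continuous p ∧ 0 < ε ∧ W = jetNhd n x U p ε}

variable {Y : Type*} [AddCommGroup Y] [Module ℂ Y] [Module A Y] [UniformSpace Y]
  [IsUniformAddGroup Y] [ContinuousSMul ℂ Y]

/-- A morphism of jet bundles over the spectrum of `A`: a continuous map of the total spaces that
maps each fiber to the fiber over the same point, linearly over `ℂ`. -/
def IsJetBundleMorphism {n m : ℕ} (μ : JetBundle A X n → JetBundle A Y m) : Prop :=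
  Continuous μ ∧ ∃ φ : ∀ t : InvolutiveSpec A, JetFiber X n t →ₗ[ℂ] JetFiber Y m t,
    ∀ (t : InvolutiveSpec A) (ξ : JetFiber X n t), μ ⟨t, ξ⟩ = ⟨t, φ t ξ⟩

end Jets

/-! ## Differential operators -/

/-- The commutator `[P, a] : x ↦ P (a · x) - a · P x`. -/
def moduleCommutator {A X Y : Type*} [SMul A X] [AddCommGroup Y] [SMul A Y]
    (P : X → Y) (a : A) : X → Y :=
  fun x => P (a • x) - a • P x

/-- `D` is a differential operator of order at most `n` between the `A`-modules `X` and `Y`: it is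
a continuous linear map, and `[… [D, a₀], … aₙ] = 0` for all `a₀, …, aₙ ∈ A`. -/
def IsDiffOp (A : Type*) {X Y : Type*} [Ring A] [AddCommGroup X] [Module ℂ X] [Module A X]
    [TopologicalSpace X] [AddCommGroup Y] [Module ℂ Y] [Module A Y] [TopologicalSpace Y]
    (n : ℕ) (D : X →L[ℂ] Y) : Prop :=
  ∀ l : List A, l.length = n + 1 → l.foldl moduleCommutator (D : X → Y) = 0

/-! ## Pseudocompletion as a functor -/

section Pseudocompletion

variable {E F : Type*} [AddCommGroup E] [Module ℂ E] [UniformSpace E] [IsUniformAddGroup E]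
  [UniformContinuousConstSMul ℂ E] [AddCommGroup F] [Module ℂ F] [UniformSpace F]
  [IsUniformAddGroup F] [UniformContinuousConstSMul ℂ F]

/-! Since `P (a • x) = a • P x + [P, a] x`, moving elements of `I_t` through `D` one at a time gives
`D (a₀ ⋯ aₙ • x) ≡ [… [D, a₀], …, aₙ] x = 0` modulo `I_t · Y`. Hence `D` descends to the quotients
by the closures, and by functoriality to their pseudocompletions. This defines the map on each
fiber.

Continuity rests on two facts. The fiber maps satisfy `q_t (D_t ξ) ≤ (q ∘ D)_t ξ` with constant one
for every `t` (`IsDiffOp.jetSeminorm_pseudocompletionMap_le`). For fixed `y`, the value `q_t (y)` is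
upper semicontinuous in `t` (`isOpen_setOf_quotientSeminorm_jetKernel_zero_lt`), because an element
of `I_t · Y` extends to a continuous family over the spectrum. Near a given jet one compares with a
section `j^n(x)`: the first fact controls the error along the fibers, the second the variation of
`j^0(D x) - j^0(y)` along the base. -/

theorem isPseudocompleteSet_pseudocompletion :
    IsPseudocompleteSet (pseudocompletion E : Set (Completion E)) := by
  rintro G hG ⟨T, hTG, hT, hTS⟩
  obtain ⟨x, hx⟩ := CompleteSpace.complete hG
  have := hG.1
  refine ⟨x, Submodule.mem_sInf.2 fun P hP => ?_, hx⟩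
  -- Limits in the completion are unique, so every competing subspace contains the same limit.
  obtain ⟨z, hz, hGz⟩ := hP.2 G hG ⟨T, hTG, hT, fun y hy => Submodule.mem_sInf.1 (hTS hy) P hP⟩
  exact tendsto_nhds_unique hx hGz ▸ hz

/-- Completeness of the source supplies the limit `x`; pseudocompleteness of `S` is only used to see
that `f x`, the unique limit of the image filter, lies in `S`. -/
theorem IsPseudocompleteSet.preimage {α β : Type*} [UniformSpace α] [CompleteSpace α]
    [UniformSpace β] [T2Space β] {f : α → β} (hf : UniformContinuous f) {S : Set β}
    (hS : IsPseudocompleteSet S) : IsPseudocompleteSet (f ⁻¹' S) := by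
  rintro G hG ⟨T, hTG, hT, hTS⟩
  obtain ⟨x, hx⟩ := CompleteSpace.complete hG
  have := hG.1
  obtain ⟨y, hy, hGy⟩ := hS (map f G) (hG.map hf)
    ⟨f '' T, image_mem_map hTG, hT.image hf, image_subset_iff.2 hTS⟩
  have hfx : Tendsto f G (𝓝 (f x)) := (hf.continuous.tendsto x).mono_left hx
  refine ⟨x, ?_, hx⟩
  rw [mem_preimage, tendsto_nhds_unique hfx hGy]
  exact hy

/-- By minimality: the preimage of `pseudocompletion F` is itself a pseudocomplete subspace
containing `E`. -/
theorem completion_mem_pseudocompletion (f : E →L[ℂ] F) {ξ : Completion E}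
    (hξ : ξ ∈ pseudocompletion E) : f.completion ξ ∈ pseudocompletion F := by
  refine Submodule.mem_sInf.1 hξ ((pseudocompletion F).comap f.completion.toLinearMap)
    ⟨fun e => ?_, ?_⟩
  · change f.completion e ∈ pseudocompletion F
    rw [ContinuousLinearMap.completion_apply_coe]
    exact coe_mem_pseudocompletion _
  · exact isPseudocompleteSet_pseudocompletion.preimage f.completion.uniformContinuous

/-- The map of pseudocompletions induced by a continuous linear map. -/
noncomputable def pseudocompletionMap (f : E →L[ℂ] F) :
    pseudocompletion E →ₗ[ℂ] pseudocompletion F :=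
  f.completion.toLinearMap.restrict fun _ => completion_mem_pseudocompletion f

end Pseudocompletion

/-! ## Quotient seminorms -/

section QuotientSeminorm

variable {X Y : Type*} [AddCommGroup X] [Module ℂ X] [UniformSpace X] [IsUniformAddGroup X]
  [AddCommGroup Y] [Module ℂ Y] [UniformSpace Y] [IsUniformAddGroup Y]

theorem continuous_completedQuotientSeminorm (N : Submodule ℂ X) (p : Seminorm ℂ X) :
    Continuous (completedQuotientSeminorm N p) :=
  Completion.continuous_extension

theorem completedQuotientSeminorm_add_le (N : Submodule ℂ X) {p : Seminorm ℂ X}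
    (hp : Continuous p) (ξ η : Completion (X ⧸ N)) :
    completedQuotientSeminorm N p (ξ + η) ≤
      completedQuotientSeminorm N p ξ + completedQuotientSeminorm N p η := by
  have hc := continuous_completedQuotientSeminorm N p
  refine Completion.induction_on₂ ξ η (isClosed_le (by fun_prop) (by fun_prop)) fun q r => ?_
  rw [← Completion.coe_add, completedQuotientSeminorm_coe N hp, completedQuotientSeminorm_coe N hp,
    completedQuotientSeminorm_coe N hp]
  simpa [add_comm] using quotientSeminorm_le_add N p (q + r) q

/-- Each lift `x` of `r` yields a lift `T x` of `f r`, so the left infimum runs over at least these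
values. -/
theorem quotientSeminorm_map_le {N : Submodule ℂ X} {M : Submodule ℂ Y} (T : X →L[ℂ] Y)
    (f : (X ⧸ N) →L[ℂ] (Y ⧸ M)) (hf : ∀ x, f (N.mkQ x) = M.mkQ (T x)) (q : Seminorm ℂ Y)
    (r : X ⧸ N) :
    quotientSeminorm M q (f r) ≤ quotientSeminorm N (q.comp T.toLinearMap) r := by
  refine le_csInf ((N.mkQ_surjective r).elim fun x hx => ⟨_, x, hx, rfl⟩) ?_
  rintro _ ⟨x, rfl, rfl⟩
  rw [hf]
  exact quotientSeminorm_mkQ_le M q (T x)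

theorem completedQuotientSeminorm_completion_le [ContinuousSMul ℂ X] [ContinuousSMul ℂ Y]
    {N : Submodule ℂ X} {M : Submodule ℂ Y} (T : X →L[ℂ] Y)
    (f : (X ⧸ N) →L[ℂ] (Y ⧸ M)) (hf : ∀ x, f (N.mkQ x) = M.mkQ (T x)) {q : Seminorm ℂ Y}
    (hq : Continuous q) (ξ : Completion (X ⧸ N)) :
    completedQuotientSeminorm M q (f.completion ξ) ≤
      completedQuotientSeminorm N (q.comp T.toLinearMap) ξ := by
  have hqT : Continuous (q.comp T.toLinearMap) := hq.comp T.continuous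
  refine Completion.induction_on ξ (isClosed_le
    ((continuous_completedQuotientSeminorm M q).comp f.completion.continuous)
    (continuous_completedQuotientSeminorm N _)) fun r => ?_
  rw [ContinuousLinearMap.completion_apply_coe, completedQuotientSeminorm_coe M hq,
    completedQuotientSeminorm_coe N hqT]
  exact quotientSeminorm_map_le T f hf q r

/-- Density of `X ⧸ N` in its completion. Both differences are bounded at once, so symmetry of the
extended seminorm is never needed. -/
theorem exists_completedQuotientSeminorm_sub_lt (N : Submodule ℂ X) {p : Seminorm ℂ X}
    (hp : Continuous p) (ξ : Completion (X ⧸ N)) {ε : ℝ} (hε : 0 < ε) :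
    ∃ x : X, completedQuotientSeminorm N p (ξ - (N.mkQ x : Completion (X ⧸ N))) < ε ∧
      completedQuotientSeminorm N p ((N.mkQ x : Completion (X ⧸ N)) - ξ) < ε := by
  have hc := continuous_completedQuotientSeminorm N p
  have h0 : completedQuotientSeminorm N p (ξ - ξ) < ε := by
    rw [sub_self, ← Completion.coe_zero, completedQuotientSeminorm_coe N hp]
    refine lt_of_le_of_lt ?_ hε
    simpa using quotientSeminorm_mkQ_le N p 0
  have hopen : IsOpen ({η | completedQuotientSeminorm N p (ξ - η) < ε} ∩
      {η | completedQuotientSeminorm N p (η - ξ) < ε}) :=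
    (isOpen_lt (by fun_prop) continuous_const).inter (isOpen_lt (by fun_prop) continuous_const)
  obtain ⟨r, hr⟩ := Completion.denseRange_coe.exists_mem_open hopen ⟨ξ, h0, h0⟩
  obtain ⟨x, rfl⟩ := N.mkQ_surjective r
  exact ⟨x, hr⟩

/-- A strict inequality is an open condition, so a witness in the closure can be moved into `N`.
This reduces closures of `I_t · Y` to finite sums. -/
theorem quotientSeminorm_topologicalClosure_lt_iff [ContinuousSMul ℂ X] (N : Submodule ℂ X)
    {p : Seminorm ℂ X} (hp : Continuous p) (x : X) (c : ℝ) :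
    quotientSeminorm N.topologicalClosure p (N.topologicalClosure.mkQ x) < c ↔
      ∃ z ∈ N, p (x + z) < c := by
  constructor
  · intro h
    have hne : {w | N.topologicalClosure.mkQ w = N.topologicalClosure.mkQ x}.Nonempty := ⟨x, rfl⟩
    obtain ⟨_, ⟨w, hw, rfl⟩, hwc⟩ := exists_lt_of_csInf_lt (hne.image p) h
    have hz : w - x ∈ closure (N : Set X) := (Submodule.Quotient.eq _).1 hw
    obtain ⟨z, hz, hzN⟩ := mem_closure_iff.1 hz {z | p (x + z) < c}
      (isOpen_lt (hp.comp (continuous_const.add continuous_id)) continuous_const) (by simpa using hwc)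
    exact ⟨z, hzN, hz⟩
  · rintro ⟨z, hz, hzc⟩
    refine lt_of_le_of_lt ?_ hzc
    have : N.topologicalClosure.mkQ x = N.topologicalClosure.mkQ (x + z) := by
      have hz0 : N.topologicalClosure.mkQ z = 0 :=
        (Submodule.Quotient.mk_eq_zero _).2 (N.le_topologicalClosure hz)
      rw [map_add, hz0, add_zero]
    rw [this]
    exact quotientSeminorm_mkQ_le _ p _

end QuotientSeminorm

/-! ## The powers of the kernel of a character -/

section Spectrum

variable {A : Type*} [Ring A] [StarRing A] [Algebra ℂ A] [UniformSpace A]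

theorem InvolutiveSpec.continuous_eval_const (a : A) :
    Continuous fun t : InvolutiveSpec A => t.eval a :=
  (UniformOnFun.uniformContinuous_eval_of_mem ℂ {S : Set A | TotallyBounded S} (mem_singleton a)
    (totallyBounded_singleton a)).continuous.comp continuous_induced_dom

variable {Y : Type*} [AddCommGroup Y] [Module ℂ Y] [Module A Y]

theorem smul_mem_kerPowSMul_one {t : InvolutiveSpec A} {a : A} (ha : t.eval a = 0) (y : Y) :
    a • y ∈ kerPowSMul Y 1 t :=
  Submodule.subset_span ⟨[a], y, rfl, by simpa using ha, by simp⟩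

/-- Induction on `l` for all maps `P`, linear or not: splitting off the first factor `a` leaves a
term `a • P _` in `I_t · Y` and replaces `P` by `[P, a]`. -/
theorem apply_prod_smul_sub_foldl_mem {X : Type*} [AddCommGroup X] [Module A X]
    (t : InvolutiveSpec A) (l : List A) (hl : ∀ a ∈ l, t.eval a = 0) (P : X → Y) (x : X) :
    P (l.prod • x) - l.foldl moduleCommutator P x ∈ kerPowSMul Y 1 t := by
  induction l generalizing P with
  | nil => simp
  | cons a l ih =>
    rw [List.forall_mem_cons] at hl
    have h := add_mem (smul_mem_kerPowSMul_one hl.1 (P (l.prod • x)))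
      (ih hl.2 (moduleCommutator P a))
    rw [List.prod_cons, mul_smul, List.foldl_cons]
    convert h using 1
    simp only [moduleCommutator]
    abel

theorem IsDiffOp.kerPowSMul_le_comap {X : Type*} [AddCommGroup X] [Module ℂ X] [Module A X]
    [TopologicalSpace X] [TopologicalSpace Y] {n : ℕ} {D : X →L[ℂ] Y} (hD : IsDiffOp A n D)
    (t : InvolutiveSpec A) :
    kerPowSMul X (n + 1) t ≤ (kerPowSMul Y 1 t).comap D.toLinearMap := by
  refine Submodule.span_le.2 ?_
  rintro _ ⟨l, x, hl, hlt, rfl⟩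
  have h := apply_prod_smul_sub_foldl_mem t l hlt D x
  rw [hD l hl] at h
  simpa using h

theorem exists_continuous_section_kerPowSMul_one [TopologicalSpace Y] [ContinuousAdd Y]
    [ContinuousSMul ℂ Y] [IsScalarTower ℂ A Y] (t₀ : InvolutiveSpec A) {z : Y}
    (hz : z ∈ kerPowSMul Y 1 t₀) :
    ∃ Z : InvolutiveSpec A → Y, Continuous Z ∧ Z t₀ = z ∧ ∀ t, Z t ∈ kerPowSMul Y 1 t := by
  induction hz using Submodule.span_induction with
  | mem z hz =>
    obtain ⟨l, y, hl, hlt, rfl⟩ := hz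
    obtain ⟨a, rfl⟩ := List.length_eq_one_iff.1 hl
    -- `a - t(a) · 1` lies in `I_t` for every `t`, varies continuously with `t`, and equals `a` at
    -- `t₀`.
    refine ⟨fun t => (a + (-t.eval a) • (1 : A)) • y, ?_, ?_, fun t => ?_⟩
    · simp only [add_smul, smul_assoc, one_smul]
      exact continuous_const.add
        ((InvolutiveSpec.continuous_eval_const a).neg.smul continuous_const)
    · simp [show t₀.eval a = 0 by simpa using hlt]
    · exact smul_mem_kerPowSMul_one (by simp [InvolutiveSpec.eval]) y
  | zero => exact ⟨fun _ => 0, continuous_const, rfl, fun t => zero_mem _⟩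
  | add z w _ _ hz hw =>
    obtain ⟨Z, hZ, rfl, hZt⟩ := hz
    obtain ⟨W, hW, rfl, hWt⟩ := hw
    exact ⟨fun t => Z t + W t, hZ.add hW, rfl, fun t => add_mem (hZt t) (hWt t)⟩
  | smul c z _ hz =>
    obtain ⟨Z, hZ, rfl, hZt⟩ := hz
    exact ⟨fun t => c • Z t, hZ.const_smul c, rfl, fun t => Submodule.smul_mem _ c (hZt t)⟩

variable [UniformSpace Y] [IsUniformAddGroup Y] [ContinuousSMul ℂ Y]

/-- The quotient seminorms of a vector depend upper semicontinuously on the character. -/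
theorem isOpen_setOf_quotientSeminorm_jetKernel_zero_lt [IsScalarTower ℂ A Y] {q : Seminorm ℂ Y}
    (hq : Continuous q) (y : Y) (c : ℝ) :
    IsOpen {t : InvolutiveSpec A |
      quotientSeminorm (jetKernel Y 0 t) q ((jetKernel Y 0 t).mkQ y) < c} := by
  have key (t : InvolutiveSpec A) := quotientSeminorm_topologicalClosure_lt_iff
    (kerPowSMul Y (0 + 1) t) hq y c
  refine isOpen_iff_mem_nhds.2 fun t₀ ht₀ => ?_
  obtain ⟨z, hz, hzc⟩ := (key t₀).1 ht₀
  obtain ⟨Z, hZ, rfl, hZt⟩ := exists_continuous_section_kerPowSMul_one t₀ hz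
  have hopen : IsOpen {t | q (y + Z t) < c} :=
    isOpen_lt (hq.comp (continuous_const.add hZ)) continuous_const
  filter_upwards [hopen.mem_nhds hzc] with t ht
  exact (key t).2 ⟨Z t, hZt t, ht⟩

end Spectrum

/-! ## The morphism of jet bundles -/

section Morphism

variable {A X Y : Type*} [Ring A] [StarRing A] [Algebra ℂ A] [UniformSpace A]
  [AddCommGroup X] [Module ℂ X] [Module A X] [UniformSpace X] [IsUniformAddGroup X]
  [ContinuousSMul ℂ X] [AddCommGroup Y] [Module ℂ Y] [Module A Y] [UniformSpace Y]
  [IsUniformAddGroup Y] [ContinuousSMul ℂ Y] {n : ℕ} {D : X →L[ℂ] Y}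

theorem IsDiffOp.jetKernel_le_comap (hD : IsDiffOp A n D) (t : InvolutiveSpec A) :
    jetKernel X n t ≤ (jetKernel Y 0 t).comap D.toLinearMap :=
  Submodule.topologicalClosure_minimal _
    ((hD.kerPowSMul_le_comap t).trans (Submodule.comap_mono (Submodule.le_topologicalClosure _)))
    ((Submodule.isClosed_topologicalClosure _).preimage D.continuous)

/-- The map `X ⧸ jetKernel X n t → Y ⧸ jetKernel Y 0 t` induced by a differential operator of
order `n`. -/
noncomputable def IsDiffOp.quotientMap (hD : IsDiffOp A n D) (t : InvolutiveSpec A) :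
    (X ⧸ jetKernel X n t) →L[ℂ] (Y ⧸ jetKernel Y 0 t) where
  toLinearMap := (jetKernel X n t).mapQ (jetKernel Y 0 t) D.toLinearMap (hD.jetKernel_le_comap t)
  cont := (jetKernel X n t).isOpenQuotientMap_mkQ.isQuotientMap.continuous_iff.2
    ((jetKernel Y 0 t).isOpenQuotientMap_mkQ.continuous.comp D.continuous)

theorem IsDiffOp.quotientMap_mkQ (hD : IsDiffOp A n D) (t : InvolutiveSpec A) (x : X) :
    hD.quotientMap t ((jetKernel X n t).mkQ x) = (jetKernel Y 0 t).mkQ (D x) :=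
  rfl

/-- The morphism of jet bundles induced by a differential operator of order `n`. -/
noncomputable def IsDiffOp.jetMap (hD : IsDiffOp A n D) (ξ : JetBundle A X n) :
    JetBundle A Y 0 :=
  ⟨ξ.proj, pseudocompletionMap (hD.quotientMap ξ.proj) ξ.val⟩

theorem IsDiffOp.pseudocompletionMap_jetAt (hD : IsDiffOp A n D) (t : InvolutiveSpec A) (x : X) :
    pseudocompletionMap (hD.quotientMap t) (jetAt n t x) = jetAt 0 t (D x) :=
  Subtype.ext (ContinuousLinearMap.completion_apply_coe _ _)

theorem jetSeminorm_add_le (t : InvolutiveSpec A) {p : Seminorm ℂ X} (hp : Continuous p)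
    (ξ η : JetFiber X n t) :
    jetSeminorm n t p (ξ + η) ≤ jetSeminorm n t p ξ + jetSeminorm n t p η :=
  completedQuotientSeminorm_add_le _ hp _ _

theorem jetSeminorm_jetAt_sub (t : InvolutiveSpec A) {p : Seminorm ℂ X} (hp : Continuous p)
    (x y : X) :
    jetSeminorm n t p (jetAt n t x - jetAt n t y) =
      quotientSeminorm (jetKernel X n t) p ((jetKernel X n t).mkQ (x - y)) := by
  rw [← completedQuotientSeminorm_coe _ hp, map_sub, Completion.coe_sub]
  rfl

theorem isOpen_jetNhd (x : X) {U : Set (InvolutiveSpec A)} (hU : IsOpen U) {p : Seminorm ℂ X}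
    (hp : Continuous p) {ε : ℝ} (hε : 0 < ε) : IsOpen (jetNhd n x U p ε) :=
  TopologicalSpace.isOpen_generateFrom_of_mem ⟨x, U, p, ε, hU, hp, hε, rfl⟩

theorem IsDiffOp.jetSeminorm_pseudocompletionMap_le (hD : IsDiffOp A n D) (t : InvolutiveSpec A)
    {q : Seminorm ℂ Y} (hq : Continuous q) (ξ : JetFiber X n t) :
    jetSeminorm 0 t q (pseudocompletionMap (hD.quotientMap t) ξ) ≤
      jetSeminorm n t (q.comp D.toLinearMap) ξ :=
  completedQuotientSeminorm_completion_le D _ (hD.quotientMap_mkQ t) hq _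

theorem IsDiffOp.continuous_jetMap [IsScalarTower ℂ A Y] (hD : IsDiffOp A n D) :
    Continuous hD.jetMap := by
  refine continuous_generateFrom_iff.2 ?_
  rintro _ ⟨y, U, q, ε, hU, hq, -, rfl⟩
  have hqD : Continuous (q.comp D.toLinearMap) := hq.comp D.continuous
  refine isOpen_iff_mem_nhds.2 ?_
  rintro ⟨t, ξ⟩ ⟨htU, hξ⟩
  change jetSeminorm 0 t q (pseudocompletionMap (hD.quotientMap t) ξ - jetAt 0 t y) < ε at hξ
  -- One `δ` pays for replacing `ξ` by the jet of `x` at `t`, the other for passing from the jet of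
  -- `x` to `η` at a nearby `s`.
  obtain ⟨δ, hδ, hξδ⟩ : ∃ δ > 0, jetSeminorm 0 t q
      (pseudocompletionMap (hD.quotientMap t) ξ - jetAt 0 t y) + 2 * δ < ε :=
    ⟨(ε - jetSeminorm 0 t q (pseudocompletionMap (hD.quotientMap t) ξ - jetAt 0 t y)) / 3,
      by linarith, by linarith⟩
  obtain ⟨x, hx, hx'⟩ := exists_completedQuotientSeminorm_sub_lt (jetKernel X n t) hqD ξ hδ
  change jetSeminorm n t (q.comp D.toLinearMap) (jetAt n t x - ξ) < δ at hx'
  have htriangle (s : InvolutiveSpec A) (u v w : JetFiber Y 0 s) :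
      jetSeminorm 0 s q (u - w) ≤ jetSeminorm 0 s q (u - v) + jetSeminorm 0 s q (v - w) := by
    simpa using jetSeminorm_add_le s hq (u - v) (v - w)
  have hle (s : InvolutiveSpec A) (η : JetFiber X n s) :=
    hD.jetSeminorm_pseudocompletionMap_le s hq η
  -- On this open subset of the base, `j^0(D x)` stays within `ε - δ` of `j^0(y)`; the smaller
  -- neighbourhood is `W(x, U ∩ V, q ∘ D, δ)`.
  have hV := isOpen_setOf_quotientSeminorm_jetKernel_zero_lt (A := A) hq (D x - y) (ε - δ)
  refine mem_of_superset ((isOpen_jetNhd x (hU.inter hV) hqD hδ).mem_nhds ⟨⟨htU, ?_⟩, hx⟩) ?_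
  -- The base point `t` belongs to `V`: going through the image of `ξ` costs less than `δ`, and
  -- `hξδ` leaves room for it.
  · change quotientSeminorm _ q _ < ε - δ
    rw [← jetSeminorm_jetAt_sub t hq]
    have h1 := htriangle t (jetAt 0 t (D x)) (pseudocompletionMap (hD.quotientMap t) ξ)
      (jetAt 0 t y)
    have h2 := hle t (jetAt n t x - ξ)
    rw [map_sub, hD.pseudocompletionMap_jetAt] at h2
    linarith
  · rintro ⟨s, η⟩ ⟨⟨hsU, hsV⟩, hη⟩
    refine ⟨hsU, ?_⟩
    change quotientSeminorm _ q _ < ε - δ at hsV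
    change jetSeminorm n s (q.comp D.toLinearMap) (η - jetAt n s x) < δ at hη
    change jetSeminorm 0 s q (pseudocompletionMap (hD.quotientMap s) η - jetAt 0 s y) < ε
    rw [← jetSeminorm_jetAt_sub s hq] at hsV
    have h1 := htriangle s (pseudocompletionMap (hD.quotientMap s) η) (jetAt 0 s (D x))
      (jetAt 0 s y)
    have h2 := hle s (η - jetAt n s x)
    rw [map_sub, hD.pseudocompletionMap_jetAt] at h2
    linarith

theorem IsDiffOp.isJetBundleMorphism_jetMap [IsScalarTower ℂ A Y] (hD : IsDiffOp A n D) :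
    IsJetBundleMorphism hD.jetMap :=
  ⟨hD.continuous_jetMap, fun t => pseudocompletionMap (hD.quotientMap t), fun _ _ => rfl⟩

theorem IsDiffOp.jetMap_jet (hD : IsDiffOp A n D) (x : X) (t : InvolutiveSpec A) :
    hD.jetMap (jet A n x t) = jet A 0 (D x) t :=
  congrArg (JetBundle.mk t) (hD.pseudocompletionMap_jetAt t x)

end Morphism

theorem mainTheorem8 {A X Y : Type*}
    [Ring A] [StarRing A] [Algebra ℂ A] [StarModule ℂ A] [UniformSpace A]
    [AddCommGroup X] [Module ℂ X] [Module A X] [IsScalarTower ℂ A X]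
    [UniformSpace X] [IsUniformAddGroup X] [ContinuousSMul ℂ X]
    [AddCommGroup Y] [Module ℂ Y] [Module A Y] [IsScalarTower ℂ A Y]
    [UniformSpace Y] [IsUniformAddGroup Y] [ContinuousSMul ℂ Y]
    (hA : IsInvolutiveStereotypeAlgebra A)
    (hX : IsStereotypeModule A X) (hY : IsStereotypeModule A Y)
    (n : ℕ) (D : X →L[ℂ] Y) (hD : IsDiffOp A n D) :
    ∃ μ : JetBundle A X n → JetBundle A Y 0,
      IsJetBundleMorphism μ ∧ ∀ x : X, jet A 0 (D x) = μ ∘ jet A n x :=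
  ⟨hD.jetMap, hD.isJetBundleMorphism_jetMap, fun x => funext fun t => (hD.jetMap_jet x t).symm⟩
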